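/- Let $\Omega\subset\mathbb R^2$ be a bounded Lipschitz domain (a bounded open set whose boundary is locally, in suitable orthogonal coordinates, the graph of a Lipschitz function, with $\Omega$ lying locally strictly above the graph), and let $\gamma$ be a finite positive Borel measure on $\Omega$. Let $\mathfrak M(\Omega,\mathbb R^2)$ be the space of $\mathbb R^2$-valued Radon measures on $\Omega$ with the Radon norm $\|\mu\|_{\mathfrak M}=|\mu|(\Omega)$, where $|\mu|$ is the variation measure of $\mu$ taken with respect to the Euclidean norm $|\cdot|_2$ of $\mathbb R^2$. For $u\in L^1(\Omega)$ let $Du$ denote the weak gradient of $u$, and put $$TV_{pwL}^{\gamma}(u):=\inf\bigl\{\|Du-g\|_{\mathfrak M} : g\in\mathfrak M(\Omega,\mathbb R^2),\ |g|\le\gamma\bigr\}\in[0,\infty],$$ where $|g|\le\gamma$ means $|g|(E)\le\gamma(E)$ for every Borel set $E\subseteq\Omega$, and where $TV_{pwL}^{\gamma}(u):=+\infty$ if $Du$ is not a measure in $\mathfrak M(\Omega,\mathbb R^2)$. Then for every $u\in L^1(\Omega)$ $$TV_{pwL}^{\gamma}(u)=\sup\Bigl\{\int_\Omega u\,\operatorname{div}\varphi\,dx-\int_\Omega|\varphi|_2\,d\gamma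 : \varphi\in C_0^\infty(\Omega;\mathbb R^2),\ |\varphi(x)|_2\le 1\text{ for all }x\in\Omega\Bigr\},$$ where $C_0^\infty(\Omega;\mathbb R^2)$ is the space of smooth vector fields with compact support in $\Omega$; both sides may equal $+\infty$. -/

import Mathlib

open MeasureTheory TopologicalSpace
open scoped ENNReal NNReal

/-- The Euclidean plane `ℝ²`; its norm is the Euclidean norm `|·|₂`. -/
abbrev Plane : Type := EuclideanSpace ℝ (Fin 2)

/-- A bounded Lipschitz domain in the plane: a bounded open set which, in some ball around each of
its boundary points and after an orthogonal change of coordinates, is the part of the ball strictly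
above the graph of a Lipschitz function of one variable. Connectedness is not demanded, so the
convention in which a domain is connected is covered as well. -/
structure IsBoundedLipschitzDomain (Ω : Opens Plane) : Prop where
  isBounded : Bornology.IsBounded (Ω : Set Plane)
  lipschitz_boundary : ∀ x₀ ∈ frontier (Ω : Set Plane),
    ∃ (r : ℝ) (e : Plane ≃ₗᵢ[ℝ] Plane) (L : ℝ≥0) (f : ℝ → ℝ), 0 < r ∧ LipschitzWith L f ∧
      (Ω : Set Plane) ∩ Metric.ball x₀ r = {x ∈ Metric.ball x₀ r | f (e x 0) < e x 1}

/-- The divergence `∂₁φ₁ + ∂₂φ₂` of a planar vector field. -/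
noncomputable def divergence (φ : Plane → Plane) (x : Plane) : ℝ :=
  ∑ i : Fin 2, fderiv ℝ φ x (EuclideanSpace.single i 1) i

/-- Lebesgue measure on `Ω`. -/
noncomputable abbrev lebesgueOn (Ω : Opens Plane) : Measure Ω :=
  (volume : Measure Plane).comap Subtype.val

/-- The space `𝔐(Ω, ℝ²)` of `ℝ²`-valued Radon measures on `Ω`: countably additive set functions
on the Borel sets of `Ω` (on an open subset of the plane these are automatically regular and of
finite total variation). -/
abbrev VectorRadonMeasure (Ω : Opens Plane) : Type := VectorMeasure Ω Plane

/-- The Radon norm `‖μ‖_𝔐 = |μ|(Ω)`, where `|μ|` is the variation measure. -/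
noncomputable def radonNorm {Ω : Opens Plane} (μ : VectorRadonMeasure Ω) : ℝ≥0∞ :=
  μ.variation Set.univ

/-- The measure `μ ∈ 𝔐(Ω, ℝ²)` is the weak gradient `Du` of `u`: for all smooth `φ : Ω → ℝ²` with
compact support in `Ω`, `∫_Ω u div φ dx = - ∫_Ω φ · dμ`. -/
def IsWeakGradient {Ω : Opens Plane} (u : Ω → ℝ) (μ : VectorRadonMeasure Ω) : Prop :=
  ∀ φ : TestFunction Ω Plane ⊤,
    ∫ x : Ω, u x * divergence φ x ∂(lebesgueOn Ω) = - ∫ᵛ x : Ω, φ (x : Plane) ∂[innerSL ℝ; μ]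

/-- `TV_pwL^γ(u)`, the infimum of `‖Du - g‖_𝔐` over all `g ∈ 𝔐(Ω, ℝ²)` with `|g| ≤ γ`. The value
is `+∞` when the weak gradient `Du` is not a measure (infimum over the empty set). -/
noncomputable def TVpwL {Ω : Opens Plane} (γ : Measure Ω) (u : Ω → ℝ) : ℝ≥0∞ :=
  ⨅ (μ : VectorRadonMeasure Ω) (_ : IsWeakGradient u μ)
    (g : VectorRadonMeasure Ω) (_ : g.variation ≤ γ), radonNorm (μ - g)

open scoped BoundedContinuousFunction CompactlySupported

/-! For `≥`, split `Du = (Du - g) + g` and pair with `φ`: the first part contributes at most `‖Du -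
g‖`, the second at most `∫ |φ| dγ`. For `≤`, let `S` be the supremum, assumed finite. Homogeneity
gives `∫ u div φ ≤ S ‖φ‖_∞ + ∫ |φ| dγ` for every test field. Hahn–Banach along the diagonal map `φ ↦
(φ, φ)` into `C_b × L¹(γ)` splits the left side as `G₁ + G₂`, with `G₁ ≤ S ‖·‖_∞` and `G₂ ≤
‖·‖_{L¹(γ)}`. By `L¹` duality `G₂` is a vector measure `m₂` with `|m₂| ≤ γ`. For `G₁`,
`exists_measure_le_integral_norm` gives a scalar measure `ν` of mass at most `S` dominating it, and
`L¹(ν)` duality then gives `m₁` with `|m₁| ≤ ν`. So `Du = -(m₁ + m₂)`, and `g = -m₂` leaves `‖Du -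
g‖ = |m₁|(Ω) ≤ S`. -/

/-- Hahn–Banach for a functional dominated along a linear map. -/
theorem exists_extension_of_comp_le {V W : Type*} [AddCommGroup V] [Module ℝ V]
    [AddCommGroup W] [Module ℝ W] (T : V →ₗ[ℝ] W) (F : V →ₗ[ℝ] ℝ) (N : Seminorm ℝ W)
    (h : ∀ v, F v ≤ N (T v)) :
    ∃ G : W →ₗ[ℝ] ℝ, (∀ v, G (T v) = F v) ∧ ∀ w, G w ≤ N w := by
  -- The bound at `v` and `-v` kills `F` on `ker T`, so `F` factors through the range of `T`.
  have hker : F ∈ (LinearMap.ker T).dualAnnihilator := by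
    rw [Submodule.mem_dualAnnihilator]
    intro v hv
    rw [LinearMap.mem_ker] at hv
    have h1 := h v
    have h2 := h (-v)
    simp only [map_neg, hv, neg_zero, map_zero] at h1 h2
    linarith
  rw [← LinearMap.range_dualMap_eq_dualAnnihilator_ker] at hker
  obtain ⟨f, rfl⟩ := hker
  obtain ⟨G, hG, hle⟩ := exists_extension_of_le_sublinear
    ⟨LinearMap.range T, f ∘ₗ (LinearMap.range T).subtype⟩ N
    (fun c hc x ↦ by rw [map_smul_eq_mul, Real.norm_of_nonneg hc.le]) (map_add_le_add N)
    (by rintro ⟨_, v, rfl⟩; exact h v)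
  exact ⟨G, fun v ↦ hG ⟨T v, v, rfl⟩, hle⟩

/-! ### Scalar measures dominating a bounded functional on vector fields -/

section Domination

variable {X E : Type*} [TopologicalSpace X] [NormedAddCommGroup E] [NormedSpace ℝ E]

/-- The supremum of a functional over all vector fields pointwise dominated by `f`. -/
noncomputable def dominatedSup (F : (X →ᵇ E) →ₗ[ℝ] ℝ) (f : C_c(X, ℝ≥0)) : ℝ :=
  sSup (F '' {φ | ∀ x, ‖φ x‖ ≤ f x})

variable {F : (X →ᵇ E) →ₗ[ℝ] ℝ} {S : ℝ≥0}

theorem bddAbove_dominated (hF : ∀ φ, F φ ≤ S * ‖φ‖) (f : C_c(X, ℝ≥0)) :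
    BddAbove (F '' {φ | ∀ x, ‖φ x‖ ≤ f x}) := by
  obtain ⟨C, hC⟩ := (NNReal.continuous_coe.comp f.continuous).bounded_above_of_compact_support
    (f.hasCompactSupport.comp_left NNReal.coe_zero)
  refine ⟨S * max C 0, ?_⟩
  rintro _ ⟨φ, hφ, rfl⟩
  refine (hF φ).trans ?_
  gcongr
  refine (BoundedContinuousFunction.norm_le (le_max_right _ _)).2 fun x ↦ ?_
  exact (hφ x).trans ((le_abs_self _).trans ((hC x).trans (le_max_left _ _)))

theorem le_dominatedSup (hF : ∀ φ, F φ ≤ S * ‖φ‖) {f : C_c(X, ℝ≥0)} {φ : X →ᵇ E}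
    (hφ : ∀ x, ‖φ x‖ ≤ f x) : F φ ≤ dominatedSup F f :=
  le_csSup (bddAbove_dominated hF f) ⟨φ, hφ, rfl⟩

theorem dominatedSup_le {f : C_c(X, ℝ≥0)} {a : ℝ}
    (h : ∀ φ : X →ᵇ E, (∀ x, ‖φ x‖ ≤ f x) → F φ ≤ a) : dominatedSup F f ≤ a := by
  refine csSup_le ⟨_, 0, fun x ↦ by simp, rfl⟩ ?_
  rintro _ ⟨φ, hφ, rfl⟩
  exact h φ hφ

theorem dominatedSup_nonneg (hF : ∀ φ, F φ ≤ S * ‖φ‖) (f : C_c(X, ℝ≥0)) :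
    0 ≤ dominatedSup F f := by
  simpa using le_dominatedSup hF (f := f) (φ := 0) (fun x ↦ by simp)

/-- For `≤`, a field below `f + g` is cut in the proportions `f : g : δ`. The extra `δ > 0` keeps
the quotients continuous where `f + g` vanishes, and its piece costs at most `S δ ≤ ε`. For `≥`,
competitors add. -/
theorem dominatedSup_add (hF : ∀ φ, F φ ≤ S * ‖φ‖) (f g : C_c(X, ℝ≥0)) :
    dominatedSup F (f + g) = dominatedSup F f + dominatedSup F g := by
  apply le_antisymm
  · refine dominatedSup_le fun ω hω ↦ le_of_forall_pos_le_add fun ε hε ↦ ?_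
    obtain ⟨δ, hδ, hδε⟩ : ∃ δ : ℝ, 0 < δ ∧ S * δ ≤ ε := by
      refine ⟨ε / (S + 1), by positivity, ?_⟩
      rw [mul_div_assoc', div_le_iff₀ (by positivity)]
      nlinarith
    have hf : Continuous fun x ↦ (f x : ℝ) := NNReal.continuous_coe.comp f.continuous
    have hg : Continuous fun x ↦ (g x : ℝ) := NNReal.continuous_coe.comp g.continuous
    have hden : ∀ x, 0 < (f x + g x + δ : ℝ) := fun x ↦ by positivity
    have part : ∀ h : X → ℝ, Continuous h → (∀ x, 0 ≤ h x) →
        (∀ x, h x ≤ f x + g x + δ) → ∃ φ : X →ᵇ E, ∀ x,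
          φ x = (h x / (f x + g x + δ)) • ω x := fun h hc h0 h1 ↦ by
      refine ⟨BoundedContinuousFunction.ofNormedAddCommGroup
        (fun x ↦ (h x / (f x + g x + δ)) • ω x) ?_ ‖ω‖ fun x ↦ ?_, fun x ↦ rfl⟩
      · exact (hc.div (by fun_prop) fun x ↦ (hden x).ne').smul ω.continuous
      · rw [norm_smul, Real.norm_of_nonneg (div_nonneg (h0 x) (hden x).le)]
        exact (mul_le_of_le_one_left (norm_nonneg _) ((div_le_one (hden x)).2 (h1 x))).trans
          (ω.norm_coe_le_norm x)
    have bound : ∀ (h : X → ℝ) (φ : X →ᵇ E), (∀ x, 0 ≤ h x) →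
        (∀ x, φ x = (h x / (f x + g x + δ)) • ω x) → ∀ x, ‖φ x‖ ≤ h x := fun h φ h0 e x ↦ by
      rw [e, norm_smul, Real.norm_of_nonneg (div_nonneg (h0 x) (hden x).le), div_mul_eq_mul_div,
        div_le_iff₀ (hden x)]
      refine mul_le_mul_of_nonneg_left ?_ (h0 x)
      have := hω x
      simp only [CompactlySupportedContinuousMap.coe_add, Pi.add_apply, NNReal.coe_add] at this
      linarith
    obtain ⟨φ, hφ⟩ := part _ hf (fun x ↦ by positivity) (fun x ↦ by
      have := (g x).coe_nonneg; linarith)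
    obtain ⟨ψ, hψ⟩ := part _ hg (fun x ↦ by positivity) (fun x ↦ by
      have := (f x).coe_nonneg; linarith)
    obtain ⟨χ, hχ⟩ := part (fun _ ↦ δ) continuous_const (fun x ↦ hδ.le) (fun x ↦ by
      have := (f x).coe_nonneg; have := (g x).coe_nonneg; linarith)
    have hsum : ω = φ + ψ + χ := by
      ext x
      have : (f x / (f x + g x + δ) + g x / (f x + g x + δ) + δ / (f x + g x + δ) : ℝ) = 1 := by
        have := (hden x).ne'
        field_simp
      simp only [BoundedContinuousFunction.add_apply, hφ, hψ, hχ, ← add_smul, this, one_smul]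
    have hχ' : F χ ≤ ε := by
      refine ((hF χ).trans ?_).trans hδε
      gcongr
      exact (BoundedContinuousFunction.norm_le hδ.le).2
        (bound (fun _ ↦ δ) χ (fun _ ↦ hδ.le) hχ)
    rw [hsum, map_add, map_add]
    have h1 := le_dominatedSup hF (bound _ φ (fun x ↦ (f x).coe_nonneg) hφ)
    have h2 := le_dominatedSup hF (bound _ ψ (fun x ↦ (g x).coe_nonneg) hψ)
    linarith
  · rw [← le_sub_iff_add_le]
    refine dominatedSup_le fun φ hφ ↦ ?_
    rw [le_sub_comm]
    refine dominatedSup_le fun ψ hψ ↦ ?_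
    rw [le_sub_iff_add_le, add_comm, ← map_add]
    exact le_dominatedSup hF fun x ↦ (norm_add_le _ _).trans (add_le_add (hφ x) (hψ x))

theorem dominatedSup_smul (hF : ∀ φ, F φ ≤ S * ‖φ‖) (c : ℝ≥0) (f : C_c(X, ℝ≥0)) :
    dominatedSup F (c • f) = c * dominatedSup F f := by
  -- Applied to `c` and to `c⁻¹`, this gives both inequalities.
  have key : ∀ (c : ℝ≥0) (f : C_c(X, ℝ≥0)), 0 < c →
      dominatedSup F f ≤ (c : ℝ)⁻¹ * dominatedSup F (c • f) := fun c f hc ↦ by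
    refine dominatedSup_le fun φ hφ ↦ ?_
    rw [le_inv_mul_iff₀ (by exact_mod_cast hc), ← smul_eq_mul, ← map_smul]
    refine le_dominatedSup hF fun x ↦ ?_
    simpa [norm_smul] using mul_le_mul_of_nonneg_left (hφ x) c.coe_nonneg
  rcases eq_or_ne c 0 with rfl | hc
  · simp only [zero_smul, NNReal.coe_zero, zero_mul]
    refine le_antisymm (dominatedSup_le fun φ hφ ↦ ?_) (dominatedSup_nonneg hF _)
    have : φ = 0 := by
      ext x
      simpa using hφ x
    simp [this]
  · have hc' : 0 < c := pos_iff_ne_zero.2 hc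
    apply le_antisymm
    · have := key c⁻¹ (c • f) (inv_pos.2 hc')
      rwa [inv_smul_smul₀ hc, NNReal.coe_inv, inv_inv] at this
    · rw [← le_inv_mul_iff₀ (by exact_mod_cast hc')]
      exact key c f hc'

/-- `dominatedSup` as a positive linear functional. -/
noncomputable def dominatedSupLinear (hF : ∀ φ, F φ ≤ S * ‖φ‖) : C_c(X, ℝ≥0) →ₗ[ℝ≥0] ℝ≥0 where
  toFun f := ⟨dominatedSup F f, dominatedSup_nonneg hF f⟩
  map_add' f g := NNReal.eq (dominatedSup_add hF f g)
  map_smul' c f := NNReal.eq (dominatedSup_smul hF c f)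

/-- A functional bounded in the uniform norm is dominated, on compactly supported fields, by
integration of the pointwise norm against a measure whose mass does not exceed the bound. -/
theorem exists_measure_le_integral_norm [T2Space X] [LocallyCompactSpace X] [MeasurableSpace X]
    [BorelSpace X] (hF : ∀ φ, F φ ≤ S * ‖φ‖) :
    ∃ ν : Measure X, ν Set.univ ≤ S ∧
      ∀ φ : X →ᵇ E, HasCompactSupport φ → F φ ≤ ∫ x, ‖φ x‖ ∂ν := by
  refine ⟨NNRealRMK.rieszMeasure (dominatedSupLinear hF), ?_, fun φ hφ ↦ ?_⟩
  · rw [isOpen_univ.measure_eq_iSup_isCompact]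
    refine iSup₂_le fun K _ ↦ iSup_le fun hK ↦ ?_
    -- A Urysohn cutoff `g` with `1_K ≤ g ≤ 1`: fields below `g` have norm at most `1`, hence `ν K ≤
    -- S`.
    obtain ⟨f, hf1, -, hfc, hf⟩ := exists_continuous_one_zero_of_isCompact hK
      (isClosed_empty (X := X)) (Set.disjoint_empty K)
    let g : C_c(X, ℝ≥0) := ⟨⟨fun x ↦ (f x).toNNReal, by fun_prop⟩,
      hfc.comp_left (g := Real.toNNReal) Real.toNNReal_zero⟩
    calc NNRealRMK.rieszMeasure (dominatedSupLinear hF) K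
        = ∫⁻ x, K.indicator 1 x ∂(NNRealRMK.rieszMeasure (dominatedSupLinear hF)) :=
          (lintegral_indicator_one hK.measurableSet).symm
      _ ≤ ∫⁻ x, g x ∂(NNRealRMK.rieszMeasure (dominatedSupLinear hF)) := by
          refine lintegral_mono (Set.indicator_le fun x hx ↦ ?_)
          simp [g, hf1 hx]
      _ = dominatedSupLinear hF g := NNRealRMK.lintegral_rieszMeasure _ _
      _ ≤ S := by
          rw [ENNReal.coe_le_coe, ← NNReal.coe_le_coe]
          refine dominatedSup_le fun φ hφ ↦ (hF φ).trans ?_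
          refine mul_le_of_le_one_right S.coe_nonneg
            ((BoundedContinuousFunction.norm_le zero_le_one).2 fun x ↦ (hφ x).trans ?_)
          simp [g, (hf x).1, (hf x).2]
  · let g : C_c(X, ℝ≥0) := ⟨⟨fun x ↦ ‖φ x‖₊, by fun_prop⟩, hφ.comp_left (g := nnnorm) nnnorm_zero⟩
    have := NNRealRMK.integral_rieszMeasure (dominatedSupLinear hF) g
    simp only [g, CompactlySupportedContinuousMap.coe_mk, ContinuousMap.coe_mk, coe_nnnorm] at this
    rw [this]
    exact le_dominatedSup hF fun x ↦ le_rfl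

end Domination

/-! ### Duality between `L¹` and dominated vector measures -/

section Representation

variable {X E : Type*} [MeasurableSpace X] [NormedAddCommGroup E] [InnerProductSpace ℝ E]
  [CompleteSpace E] {ν : Measure X} [IsFiniteMeasure ν]

/-- The dual of `L¹`, represented by vector measures dominated by the base measure. -/
theorem exists_vectorMeasure_of_le_norm (G : Lp E 1 ν →ₗ[ℝ] ℝ) (hG : ∀ f, G f ≤ ‖f‖) :
    ∃ m : VectorMeasure X E, m.variation ≤ ν ∧
      ∀ f : Lp E 1 ν, ∫ᵛ x, f x ∂[innerSL ℝ; m] = G f := by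
  classical
  have hG' : ∀ f, ‖G f‖ ≤ 1 * ‖f‖ := fun f ↦ by
    rw [one_mul, Real.norm_eq_abs, abs_le]
    have := hG (-f)
    rw [map_neg, norm_neg] at this
    exact ⟨by linarith, hG f⟩
  have hadd : ∀ (s : Set X) (hs : MeasurableSet s) (c d : E),
      indicatorConstLp 1 hs (measure_ne_top ν s) (c + d) =
        indicatorConstLp 1 hs (measure_ne_top ν s) c +
        indicatorConstLp 1 hs (measure_ne_top ν s) d := fun s hs c d ↦
    indicatorConstLp_add.symm
  have hsmul : ∀ (s : Set X) (hs : MeasurableSet s) (a : ℝ) (c : E),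
      indicatorConstLp 1 hs (measure_ne_top ν s) (a • c) =
        a • indicatorConstLp 1 hs (measure_ne_top ν s) c := fun s hs a c ↦ by
      rw [indicatorConstLp, indicatorConstLp, ← MemLp.toLp_const_smul]
      congr 1
      exact Set.indicator_const_smul s a fun _ ↦ c
  -- The value of the measure on `s` is the Riesz vector of `c ↦ G (1_s c)`, whose norm is at most
  -- `ν s`.
  let ℓ : ∀ s : Set X, MeasurableSet s → (E →L[ℝ] ℝ) := fun s hs ↦
    LinearMap.mkContinuous
      { toFun c := G (indicatorConstLp 1 hs (measure_ne_top ν s) c)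
        map_add' c d := by rw [hadd, map_add]
        map_smul' a c := by rw [hsmul, map_smul, RingHom.id_apply] } (ν.real s) fun c ↦ by
      refine (hG' _).trans_eq ?_
      rw [norm_indicatorConstLp one_ne_zero ENNReal.one_ne_top]
      simp [mul_comm]
  let m₀ : Set X → E := fun s ↦
    if hs : MeasurableSet s then (InnerProductSpace.toDual ℝ E).symm (ℓ s hs) else 0
  have hm₀ : ∀ s, ‖m₀ s‖ₑ ≤ ν s := fun s ↦ by
    by_cases hs : MeasurableSet s
    · simp only [m₀, hs, dif_pos]
      rw [← ofReal_norm, LinearIsometryEquiv.norm_map, ← ofReal_measureReal]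
      exact ENNReal.ofReal_le_ofReal (LinearMap.mkContinuous_norm_le _ measureReal_nonneg _)
    · simp [m₀, hs]
  let m : VectorMeasure X E := VectorMeasure.of_additive_of_le_measure (μ := ν) m₀ hm₀
    (fun s t hs ht hst ↦ by
      simp only [m₀, hs, ht, hs.union ht, dif_pos, ← map_add]
      congr 1
      ext c
      simp only [ℓ, LinearMap.mkContinuous_apply, LinearMap.coe_mk, AddHom.coe_mk,
        _root_.add_apply, ← map_add]
      congr 1
      exact indicatorConstLp_disjoint_union hs ht (measure_ne_top ν s) (measure_ne_top ν t) hst c)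
    (fun s hs ↦ by simp [m₀, hs])
  have hm : m.variation ≤ ν := VectorMeasure.variation_le_of_forall_enorm_le fun s _ ↦ hm₀ s
  refine ⟨m, hm, fun f ↦ ?_⟩
  -- Taking `ν` as base measure makes the integral continuous on `L¹(ν)`, so agreement with `G` need
  -- only be checked on indicators.
  have hdom : DominatedFinMeasAdditive ν (m.transpose (innerSL ℝ)) _ :=
    (dominatedFinMeasAdditive_cbmApplyMeasure m (innerSL ℝ)).of_measure_le hm
      (ContinuousLinearMap.opNorm_nonneg _)
  have hint : ∀ g : X → E, Integrable g ν →
      ∫ᵛ x, g x ∂[innerSL ℝ; m] = setToFun ν (m.transpose (innerSL ℝ)) hdom g := fun g hg ↦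
    (setToFun_congr_measure_of_integrable 1 ENNReal.coe_ne_top (by simpa using hm) _ _ g hg).symm
  rw [hint f (L1.integrable_coeFn f)]
  refine Lp.induction ENNReal.one_ne_top
    (motive := fun f ↦ setToFun ν (m.transpose (innerSL ℝ)) hdom f = G f) ?_ ?_ ?_ f
  · intro c s hs hνs
    rw [Lp.simpleFunc.coe_indicatorConst, setToFun_congr_ae hdom indicatorConstLp_coeFn,
      setToFun_indicator_const hdom hs hνs.ne]
    change innerSL ℝ c (m₀ s) = _
    simp only [m₀, hs, dif_pos]
    rw [innerSL_apply_apply, real_inner_comm, InnerProductSpace.toDual_symm_apply]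
    rfl
  · intro f g hf hg _ hf' hg'
    rw [setToFun_congr_ae hdom (Lp.coeFn_add _ _), setToFun_add hdom, hf', hg', map_add]
    · exact L1.integrable_coeFn _
    · exact L1.integrable_coeFn _
  · exact isClosed_eq (continuous_setToFun hdom) (G.mkContinuous 1 hG').continuous

/-- A functional dominated along `T` by the `L¹`-norm is integration of `T v` against a vector
measure dominated by the base measure. -/
theorem exists_vectorMeasure_of_comp_le_norm {V : Type*} [AddCommGroup V] [Module ℝ V]
    (T : V →ₗ[ℝ] Lp E 1 ν) (F : V →ₗ[ℝ] ℝ) (h : ∀ v, F v ≤ ‖T v‖) :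
    ∃ m : VectorMeasure X E, m.variation ≤ ν ∧ ∀ v, ∫ᵛ x, T v x ∂[innerSL ℝ; m] = F v := by
  obtain ⟨G, hGT, hG⟩ := exists_extension_of_comp_le T F (normSeminorm ℝ _) h
  obtain ⟨m, hm, hmG⟩ := exists_vectorMeasure_of_le_norm G hG
  exact ⟨m, hm, fun v ↦ by rw [hmG, hGT]⟩

end Representation

/-! ### Test fields as bounded continuous and as integrable fields -/

section TestFields

variable {Ω : Opens Plane}

theorem divergence_add {φ ψ : Plane → Plane} (hφ : Differentiable ℝ φ) (hψ : Differentiable ℝ ψ)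
    (x : Plane) : divergence (φ + ψ) x = divergence φ x + divergence ψ x := by
  simp [divergence, fderiv_add (hφ x) (hψ x)]
  ring

theorem divergence_smul {φ : Plane → Plane} (hφ : Differentiable ℝ φ) (c : ℝ) (x : Plane) :
    divergence (c • φ) x = c * divergence φ x := by
  simp [divergence, fderiv_const_smul (hφ x) c, mul_add]

theorem TestFunction.differentiable (φ : TestFunction Ω Plane ⊤) : Differentiable ℝ φ :=
  φ.contDiff.differentiable (by simp)

theorem TestFunction.continuous_divergence (φ : TestFunction Ω Plane ⊤) :
    Continuous (divergence φ) := by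
  have h : Continuous (fderiv ℝ φ) := φ.contDiff.continuous_fderiv (by simp)
  unfold divergence
  fun_prop

theorem TestFunction.exists_divergence_bound (φ : TestFunction Ω Plane ⊤) :
    ∃ C, ∀ x, ‖divergence φ x‖ ≤ C := by
  refine φ.continuous_divergence.bounded_above_of_compact_support
    ((φ.hasCompactSupport.fderiv ℝ).mono fun x hx h ↦ hx ?_)
  simp [divergence, h]

theorem TestFunction.integrable_mul_divergence {u : Ω → ℝ} (hu : Integrable u (lebesgueOn Ω))
    (φ : TestFunction Ω Plane ⊤) :
    Integrable (fun x : Ω ↦ u x * divergence φ x) (lebesgueOn Ω) := by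
  obtain ⟨C, hC⟩ := φ.exists_divergence_bound
  exact hu.mul_bdd (c := C)
    (φ.continuous_divergence.comp continuous_subtype_val).aestronglyMeasurable
    (Filter.Eventually.of_forall fun x ↦ hC x)

/-- The functional `φ ↦ ∫_Ω u div φ dx`. -/
noncomputable def divergenceFunctional {u : Ω → ℝ} (hu : Integrable u (lebesgueOn Ω)) :
    TestFunction Ω Plane ⊤ →ₗ[ℝ] ℝ where
  toFun φ := ∫ x : Ω, u x * divergence φ x ∂(lebesgueOn Ω)
  map_add' φ ψ := by
    rw [← integral_add (φ.integrable_mul_divergence hu) (ψ.integrable_mul_divergence hu)]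
    congr 1
    ext x
    rw [FunLike.coe_add, divergence_add φ.differentiable ψ.differentiable, mul_add]
  map_smul' c φ := by
    rw [RingHom.id_apply, smul_eq_mul, ← integral_const_mul]
    congr 1
    ext x
    rw [FunLike.coe_smul, divergence_smul φ.differentiable]
    ring

/-- Restriction of a test field to its domain. -/
noncomputable def TestFunction.restrict : TestFunction Ω Plane ⊤ →ₗ[ℝ] (Ω →ᵇ Plane) where
  toFun φ := (φ : Plane →ᵇ Plane).compContinuous ⟨Subtype.val, continuous_subtype_val⟩
  map_add' φ ψ := by ext; rfl
  map_smul' c φ := by ext; rfl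

@[simp]
theorem TestFunction.restrict_apply (φ : TestFunction Ω Plane ⊤) (x : Ω) :
    TestFunction.restrict φ x = φ x := rfl

theorem TestFunction.hasCompactSupport_restrict (φ : TestFunction Ω Plane ⊤) :
    HasCompactSupport (TestFunction.restrict φ) := by
  have hK : IsCompact (Subtype.val ⁻¹' tsupport φ : Set Ω) := by
    refine Topology.IsInducing.subtypeVal.isCompact_preimage' φ.hasCompactSupport ?_
    simpa using φ.tsupport_subset
  refine HasCompactSupport.intro hK fun x hx ↦ ?_
  exact image_eq_zero_of_notMem_tsupport (f := φ) hx

/-- Reconciles the constraint on the whole plane with the sup norm over `Ω`: `φ` vanishes off `Ω`.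
-/
theorem TestFunction.norm_apply_le_norm_restrict (φ : TestFunction Ω Plane ⊤) (x : Plane) :
    ‖φ x‖ ≤ ‖TestFunction.restrict φ‖ := by
  by_cases hx : x ∈ Ω
  · exact (TestFunction.restrict φ).norm_coe_le_norm ⟨x, hx⟩
  · rw [image_eq_zero_of_notMem_tsupport fun h ↦ hx (φ.tsupport_subset h), norm_zero]
    exact norm_nonneg _

theorem TestFunction.integrable_restrict (φ : TestFunction Ω Plane ⊤) (ν : Measure Ω) [IsFiniteMeasure ν] :
    Integrable (fun x : Ω ↦ φ (x : Plane)) ν :=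
  (TestFunction.restrict φ).integrable ν

/-- A test field as an element of `L¹(ν)`. -/
noncomputable def TestFunction.toL1 (ν : Measure Ω) [IsFiniteMeasure ν] :
    TestFunction Ω Plane ⊤ →ₗ[ℝ] Lp Plane 1 ν :=
  (BoundedContinuousFunction.toLp 1 ν ℝ).toLinearMap ∘ₗ TestFunction.restrict

theorem TestFunction.coeFn_toL1 (ν : Measure Ω) [IsFiniteMeasure ν] (φ : TestFunction Ω Plane ⊤) :
    TestFunction.toL1 ν φ =ᵐ[ν] fun x : Ω ↦ φ (x : Plane) :=
  BoundedContinuousFunction.coeFn_toLp 1 ν ℝ (TestFunction.restrict φ)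

theorem TestFunction.norm_toL1 (ν : Measure Ω) [IsFiniteMeasure ν] (φ : TestFunction Ω Plane ⊤) :
    ‖TestFunction.toL1 ν φ‖ = ∫ x : Ω, ‖φ (x : Plane)‖ ∂ν := by
  rw [L1.norm_eq_integral_norm]
  exact integral_congr_ae ((TestFunction.coeFn_toL1 ν φ).fun_comp norm)

theorem TestFunction.integral_toL1 {ν : Measure Ω} [IsFiniteMeasure ν] {m : VectorRadonMeasure Ω}
    (hm : m.variation ≤ ν) (φ : TestFunction Ω Plane ⊤) :
    ∫ᵛ x, TestFunction.toL1 ν φ x ∂[innerSL ℝ; m] =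
      ∫ᵛ x : Ω, φ (x : Plane) ∂[innerSL ℝ; m] :=
  VectorMeasure.integral_congr_ae
    ((Measure.absolutelyContinuous_of_le hm).ae_le (TestFunction.coeFn_toL1 ν φ))

end TestFields

/-! ### The two inequalities -/

theorem abs_integral_innerSL_le {Ω : Opens Plane} (m : VectorRadonMeasure Ω) (f : Ω → Plane) :
    |∫ᵛ x, f x ∂[innerSL ℝ; m]| ≤ ∫ x, ‖f x‖ ∂m.variation := by
  refine (VectorMeasure.norm_integral_le_integral_norm (B := innerSL ℝ)).trans ?_
  exact mul_le_of_le_one_left (integral_nonneg fun _ ↦ norm_nonneg _) (norm_innerSL_le ℝ)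

/-- Every admissible test field bounds `‖Du - g‖` from below. -/
theorem sub_le_radonNorm {Ω : Opens Plane} {γ : Measure Ω} [IsFiniteMeasure γ] {u : Ω → ℝ}
    {μ g : VectorRadonMeasure Ω} (hμ : IsWeakGradient u μ) (hg : g.variation ≤ γ)
    (φ : TestFunction Ω Plane ⊤) (hφ : ∀ x, ‖φ x‖ ≤ 1) :
    (((∫ x : Ω, u x * divergence φ x ∂(lebesgueOn Ω)) -
      ∫ x : Ω, ‖φ (x : Plane)‖ ∂γ : ℝ) : EReal) ≤ (radonNorm (μ - g) : EReal) := by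
  by_cases htop : radonNorm (μ - g) = ⊤
  · simp [htop]
  have : IsFiniteMeasure (μ - g).variation := ⟨lt_top_iff_ne_top.2 htop⟩
  have : IsFiniteMeasure g.variation := isFiniteMeasure_of_le γ hg
  have hsplit : ∫ᵛ x : Ω, φ (x : Plane) ∂[innerSL ℝ; μ] =
      ∫ᵛ x : Ω, φ (x : Plane) ∂[innerSL ℝ; μ - g] + ∫ᵛ x : Ω, φ (x : Plane) ∂[innerSL ℝ; g] := by
    rw [← VectorMeasure.integral_add_vectorMeasure (φ.integrable_restrict _) (φ.integrable_restrict _),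
      sub_add_cancel]
  have h1 := abs_integral_innerSL_le (μ - g) fun x : Ω ↦ φ (x : Plane)
  have h2 := abs_integral_innerSL_le g fun x : Ω ↦ φ (x : Plane)
  have h3 : ∫ x : Ω, ‖φ (x : Plane)‖ ∂g.variation ≤ ∫ x : Ω, ‖φ (x : Plane)‖ ∂γ :=
    integral_mono_measure hg (Filter.Eventually.of_forall fun _ ↦ norm_nonneg _)
      (φ.integrable_restrict γ).norm
  have h4 : ∫ x : Ω, ‖φ (x : Plane)‖ ∂(μ - g).variation ≤ (radonNorm (μ - g)).toReal := by
    refine (integral_mono (φ.integrable_restrict _).norm (integrable_const 1) fun x ↦ hφ x).trans_eq ?_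
    simp [radonNorm, Measure.real]
  rw [hμ φ, hsplit, ← EReal.coe_toReal (x := (radonNorm (μ - g) : EReal)) (by simpa using htop)
    (by simp), EReal.coe_le_coe_iff, EReal.toReal_coe_ennreal]
  linarith [neg_abs_le (∫ᵛ x : Ω, φ (x : Plane) ∂[innerSL ℝ; μ - g]),
    neg_abs_le (∫ᵛ x : Ω, φ (x : Plane) ∂[innerSL ℝ; g])]

/-- A bound on the dual functional yields a weak gradient together with a competitor. -/
theorem TVpwL_le_of_forall_le {Ω : Opens Plane} {γ : Measure Ω} [IsFiniteMeasure γ] {u : Ω → ℝ}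
    (hu : Integrable u (lebesgueOn Ω)) (S : ℝ≥0)
    (hS : ∀ φ : TestFunction Ω Plane ⊤, (∀ x, ‖φ x‖ ≤ 1) →
      (∫ x : Ω, u x * divergence φ x ∂(lebesgueOn Ω)) - ∫ x : Ω, ‖φ (x : Plane)‖ ∂γ ≤ S) :
    TVpwL γ u ≤ S := by
  have : LocallyCompactSpace Ω := Ω.isOpen.locallyCompactSpace
  let N : Seminorm ℝ ((Ω →ᵇ Plane) × Lp Plane 1 γ) :=
    S • (normSeminorm ℝ (Ω →ᵇ Plane)).comp (LinearMap.fst ℝ (Ω →ᵇ Plane) (Lp Plane 1 γ)) +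
      (normSeminorm ℝ (Lp Plane 1 γ)).comp (LinearMap.snd ℝ (Ω →ᵇ Plane) (Lp Plane 1 γ))
  have hN : ∀ w, N w = S * ‖w.1‖ + ‖w.2‖ := fun w ↦ rfl
  have hbound : ∀ φ : TestFunction Ω Plane ⊤, divergenceFunctional hu φ ≤
      N (TestFunction.restrict.prod (TestFunction.toL1 γ) φ) := fun φ ↦ by
    rw [hN]
    simp only [LinearMap.prod_apply, Function.prod_apply]
    rcases eq_or_ne ‖TestFunction.restrict φ‖ 0 with h0 | h0
    · have : φ = 0 := by
        ext1 x
        have := φ.norm_apply_le_norm_restrict x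
        rw [h0] at this
        exact norm_le_zero_iff.1 this
      subst this
      simp
    · set c := ‖TestFunction.restrict φ‖
      have hc : 0 < c := lt_of_le_of_ne (norm_nonneg _) h0.symm
      -- The normalised field is admissible in `hS`; scaling back gives the bound for `φ`.
      have key : divergenceFunctional hu (c⁻¹ • φ) ≤ S + ‖TestFunction.toL1 γ (c⁻¹ • φ)‖ := by
        rw [TestFunction.norm_toL1, ← sub_le_iff_le_add]
        refine hS _ fun x ↦ ?_
        rw [_root_.smul_apply, norm_smul, norm_inv, Real.norm_of_nonneg hc.le,
          inv_mul_le_iff₀ hc, mul_one]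
        exact φ.norm_apply_le_norm_restrict x
      rw [map_smul, map_smul, norm_smul, norm_inv, Real.norm_of_nonneg hc.le, smul_eq_mul,
        inv_mul_le_iff₀ hc, mul_add, mul_inv_cancel_left₀ h0] at key
      linarith
  obtain ⟨G, hGT, hG⟩ := exists_extension_of_comp_le
    (TestFunction.restrict.prod (TestFunction.toL1 γ)) (divergenceFunctional hu) N hbound
  have hG₁ : ∀ φ, (G ∘ₗ LinearMap.inl ℝ _ _) φ ≤ S * ‖φ‖ := fun φ ↦ by
    simpa [hN] using hG (φ, 0)
  have hG₂ : ∀ f, (G ∘ₗ LinearMap.inr ℝ _ _) f ≤ ‖f‖ := fun f ↦ by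
    simpa [hN] using hG (0, f)
  obtain ⟨ν, hν, hνG⟩ := exists_measure_le_integral_norm hG₁
  have : IsFiniteMeasure ν := ⟨hν.trans_lt ENNReal.coe_lt_top⟩
  -- `ν` controls `G₁` only on compactly supported fields, so a second Hahn–Banach extension, from
  -- test fields to `L¹(ν)`, is needed.
  obtain ⟨m₁, hm₁, hm₁G⟩ := exists_vectorMeasure_of_comp_le_norm (TestFunction.toL1 ν)
    ((G ∘ₗ LinearMap.inl ℝ _ _) ∘ₗ TestFunction.restrict) fun φ ↦ by
      rw [TestFunction.norm_toL1]
      exact hνG _ φ.hasCompactSupport_restrict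
  obtain ⟨m₂, hm₂, hm₂G⟩ := exists_vectorMeasure_of_le_norm _ hG₂
  have : IsFiniteMeasure m₁.variation := isFiniteMeasure_of_le ν hm₁
  have : IsFiniteMeasure m₂.variation := isFiniteMeasure_of_le γ hm₂
  have hgrad : IsWeakGradient u (-(m₁ + m₂)) := fun φ ↦ by
    rw [VectorMeasure.integral_neg_vectorMeasure, neg_neg,
      VectorMeasure.integral_add_vectorMeasure (φ.integrable_restrict _) (φ.integrable_restrict _),
      ← TestFunction.integral_toL1 hm₁, ← TestFunction.integral_toL1 hm₂, hm₁G, hm₂G]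
    refine (hGT φ).symm.trans ?_
    simp only [LinearMap.comp_apply, LinearMap.inl_apply, LinearMap.inr_apply, ← map_add]
    simp
  refine (iInf₂_le_of_le _ hgrad (iInf₂_le (-m₂) ?_)).trans ?_
  · rwa [VectorMeasure.variation_neg]
  · rw [show -(m₁ + m₂) - -m₂ = -m₁ by abel, radonNorm, VectorMeasure.variation_neg]
    exact (hm₁ _).trans hν

theorem theorem1 (Ω : Opens Plane) (hΩ : IsBoundedLipschitzDomain Ω)
    (γ : Measure Ω) [IsFiniteMeasure γ] (u : Ω → ℝ) (hu : Integrable u (lebesgueOn Ω)) :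
    (TVpwL γ u : EReal) =
      ⨆ (φ : TestFunction Ω Plane ⊤) (_ : ∀ x, ‖φ x‖ ≤ 1),
        (((∫ x : Ω, u x * divergence φ x ∂(lebesgueOn Ω)) -
          ∫ x : Ω, ‖φ (x : Plane)‖ ∂γ : ℝ) : EReal) := by
  apply le_antisymm
  · set s := ⨆ (φ : TestFunction Ω Plane ⊤) (_ : ∀ x, ‖φ x‖ ≤ 1),
        (((∫ x : Ω, u x * divergence φ x ∂(lebesgueOn Ω)) -
          ∫ x : Ω, ‖φ (x : Plane)‖ ∂γ : ℝ) : EReal) with hs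
    have hle : ∀ φ : TestFunction Ω Plane ⊤, (∀ x, ‖φ x‖ ≤ 1) →
        (((∫ x : Ω, u x * divergence φ x ∂(lebesgueOn Ω)) -
          ∫ x : Ω, ‖φ (x : Plane)‖ ∂γ : ℝ) : EReal) ≤ s := fun φ hφ ↦
      le_iSup₂_of_le φ hφ le_rfl
    clear_value s
    -- The zero field is admissible, which rules out `⊥` and negative values.
    have h0 : 0 ≤ s := by
      simpa [divergence] using hle 0 (by simp)
    induction s with
    | bot => simp at h0
    | top => exact le_top
    | coe r =>
      lift r to ℝ≥0 using by exact_mod_cast h0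
      have := TVpwL_le_of_forall_le hu r fun φ hφ ↦ by exact_mod_cast hle φ hφ
      rw [← EReal.coe_ennreal_le_coe_ennreal_iff] at this
      exact this
  · refine iSup₂_le fun φ hφ ↦ ?_
    have h : ∀ μ g, IsWeakGradient u μ → g.variation ≤ γ → _ ≤ (radonNorm (μ - g) : EReal) :=
      fun μ g hμ hg ↦ sub_le_radonNorm hμ hg φ hφ
    generalize (∫ x : Ω, u x * divergence φ x ∂(lebesgueOn Ω)) -
      ∫ x : Ω, ‖φ (x : Plane)‖ ∂γ = r at h ⊢
    rcases le_total r 0 with hr | hr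
    · exact (EReal.coe_le_coe_iff.2 hr).trans (EReal.coe_ennreal_nonneg _)
    · lift r to ℝ≥0 using hr
      have h' : (r : ℝ≥0∞) ≤ TVpwL γ u := le_iInf₂ fun μ hμ ↦ le_iInf₂ fun g hg ↦
        EReal.coe_ennreal_le_coe_ennreal_iff.1 (h μ g hμ hg)
      exact EReal.coe_ennreal_le_coe_ennreal_iff.2 h'
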